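/- For $g\colon\mathbb C\to\mathbb C$ let $$Tg(z)=\frac1\pi\int_{\mathbb C}\frac{g(w)}{z-w}\,dA(w),\qquad Hg(z)=-\lim_{\epsilon\to0^+}\frac1\pi\int_{\mathbb C\setminus B(z,\epsilon)}\frac{g(w)}{(w-z)^2}\,dA(w)$$ be the Cauchy transform and the Beurling–Ahlfors transform (with the sign for which $\partial_z(Tg)=Hg$). For $\mu\colon\mathbb C\to\mathbb C$ put $(H\mu)^1=H\mu$ and $(H\mu)^{n+1}=H\big(\mu\,(H\mu)^n\big)$ for $n\ge1$. **Theorem.** Let $0<\alpha\le1$ and $A\ge0$. There is $R_0=R_0(\alpha,A)>0$ such that the following holds for every $0<R\le R_0$. Let $\mu\colon\mathbb C\to\mathbb C$ satisfy $|\mu(z)-\mu(w)|\le A|z-w|^\alpha$ for all $z,w\in\mathbb C$, $\|\mu\|_\infty<1$, and let $\mu$ have compact support contained in $B(0,R)$. Then all the functions $(H\mu)^n$, $n\ge1$, are well defined on $\mathbb C$ (the principal values exist at every point), the series $$h=\sum_{n=1}^\infty(H\mu)^n$$ converges uniformly on $\mathbb C$, the integral defining $T(\mu+\mu h)$ converges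 absolutely at every point, and the map $$f(z)=z+T(\mu+\mu h)(z)$$ is continuously differentiable on $B(0,R)$, satisfies $f_{\bar z}=\mu f_z$ at every point of $B(0,R)$, and restricts to a homeomorphism of $B(0,R)$ onto its image. -/

import Mathlib

open Filter Topology MeasureTheory Metric
open scoped NNReal ENNReal

noncomputable section

/-- The Wirtinger derivative `∂f/∂z = (f_x - i f_y) / 2`. -/
def wirtingerZ (f : ℂ → ℂ) (z : ℂ) : ℂ :=
  (fderiv ℝ f z 1 - Complex.I * fderiv ℝ f z Complex.I) / 2

/-- The Wirtinger derivative `∂f/∂z̄ = (f_x + i f_y) / 2`. -/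
def wirtingerZbar (f : ℂ → ℂ) (z : ℂ) : ℂ :=
  (fderiv ℝ f z 1 + Complex.I * fderiv ℝ f z Complex.I) / 2

/-- The Cauchy transform `T g (z) = π⁻¹ ∫ g(w) / (z - w) dA(w)`. -/
def cauchyT (g : ℂ → ℂ) (z : ℂ) : ℂ :=
  (1 / (Real.pi : ℂ)) * ∫ w, g w / (z - w)

/-- The truncated Beurling integral `-π⁻¹ ∫_{ℂ ∖ B(z, ε)} g(w) / (w - z)² dA(w)`. -/
def truncatedBeurling (g : ℂ → ℂ) (z : ℂ) (ε : ℝ) : ℂ :=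
  -(1 / (Real.pi : ℂ)) * ∫ w in (ball z ε)ᶜ, g w / (w - z) ^ 2

/-- The principal value integral defining the Beurling transform of `g` at `z` makes sense:
the truncated integrals converge absolutely, and they have a limit as `ε → 0+`. -/
def BeurlingConvergesAt (g : ℂ → ℂ) (z : ℂ) : Prop :=
  (∀ ε : ℝ, 0 < ε → IntegrableOn (fun w => g w / (w - z) ^ 2) (ball z ε)ᶜ) ∧
    ∃ l : ℂ, Tendsto (truncatedBeurling g z) (𝓝[>] 0) (𝓝 l)

/-- The Beurling–Ahlfors transform `H g (z)`, a principal value integral. The sign is the one for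
which `∂_z (T g) = H g`. -/
def beurlingH (g : ℂ → ℂ) (z : ℂ) : ℂ :=
  limUnder (𝓝[>] (0 : ℝ)) (truncatedBeurling g z)

/-- `(Hμ)ⁿ`, that is, the `n`-th iterate of the operator `g ↦ H (μ g)`, applied to the constant
function `1`. So `(Hμ)¹` is the function `H μ`, and `(Hμ)ⁿ⁺¹ = H (μ (Hμ)ⁿ)`. -/
def beurlingPow (μ : ℂ → ℂ) (n : ℕ) : ℂ → ℂ :=
  (fun g : ℂ → ℂ => beurlingH (fun w => μ w * g w))^[n] (fun _ => 1)

/-- `h = ∑_{n ≥ 1} (Hμ)ⁿ`. -/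
def neumannH (μ : ℂ → ℂ) (z : ℂ) : ℂ :=
  ∑' n : ℕ, beurlingPow μ (n + 1) z

/-- `f(z) = z + T (μ + μ h) (z)` with `h = ∑_{n ≥ 1} (Hμ)ⁿ`. -/
def beltramiMap (μ : ℂ → ℂ) (z : ℂ) : ℂ :=
  z + cauchyT (fun w => μ w + μ w * neumannH μ w) z

end

/-!
The idea is to work with a Hölder exponent `β < 1`, a small Hölder constant, and support in the unit
disc; `HolderBound.of_support_subset_ball` makes this reduction with `β = α / 2`, since a Hölder
function supported in a small ball has a small `β`-Hölder constant. This also takes care of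
`α = 1`, where the Beurling transform would lose regularity.

On compactly supported Hölder functions both transforms are controlled by elementary estimates. The
principal value exists because the kernel `u⁻²` integrates to zero over annuli, so that
`g z` may be subtracted near the singularity (`beurlingH_eq`). Both transforms are covariant
under `u ↦ z + e u` with `e` complex (`beurlingH_affine`, `cauchyT_affine`), so it suffices to
compare values at `0` and `1`, with constants which do not depend on the support:

* `HolderBound.beurlingH`: `H` preserves the Hölder class. The far part of the kernel is even, hence
  its increment has integral zero (`integral_farKernel_sub`).
* `hasFDerivAt_cauchyT`: `∂_z (T g) = H g` and `∂_z̄ (T g) = g`. The remainder of the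
  expansion of `T g` is an integral against `1 / (u ^ 2 (1 - u))`, whose principal value
  is `π` by averaging over circles (`integral_remainderKernel`).

The kernels in these estimates are dominated by `‖u‖ ^ (β - 2) / ‖1 - u‖`, which is integrable over
the plane. If the Hölder constant of `μ` is small, `P ↦ H (μ P)` is thus a strict contraction in the
sup norm and in the Hölder seminorm together, the Neumann series converges geometrically, and
`H (μ (1 + h)) = h` (`beurlingH_mul_neumannTail_zero`). Hence `f_z̄ = μ (1 + h) = μ f_z`, and
`f - id` is Lipschitz with constant `1 / 2`, which makes `f` an embedding of the whole plane.
-/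

open scoped ComplexConjugate

/-! ### Integrals over the plane -/

lemma map_mul_left_volume_complex {e : ℂ} (he : e ≠ 0) :
    Measure.map (fun u : ℂ => e * u) volume = ENNReal.ofReal (‖e‖ ^ 2)⁻¹ • volume := by
  have hdet : LinearMap.det (LinearMap.mul ℝ ℂ e) = ‖e‖ ^ 2 := by
    rw [← Complex.normSq_eq_norm_sq, ← Algebra.norm_complex_apply, Algebra.norm_apply]
    rfl
  have h := Measure.map_linearMap_addHaar_eq_smul_addHaar (volume : Measure ℂ)
    (f := LinearMap.mul ℝ ℂ e) (by rw [hdet]; simpa using he)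
  rw [hdet, abs_of_nonneg (by positivity)] at h
  exact h

lemma integral_comp_mul_left_complex {e : ℂ} (he : e ≠ 0) (F : ℂ → ℂ) :
    ∫ u, F (e * u) = ((‖e‖ : ℂ) ^ 2)⁻¹ * ∫ u, F u := by
  have hemb : MeasurableEmbedding (fun u : ℂ => e * u) := measurableEmbedding_mulLeft₀ he
  rw [← hemb.integral_map, map_mul_left_volume_complex he, integral_smul_measure,
    ENNReal.toReal_ofReal (by positivity), Complex.real_smul]
  push_cast
  rfl

lemma integrableOn_norm_rpow_ball {s : ℝ} (hs : -2 < s) (r : ℝ) :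
    IntegrableOn (fun u : ℂ => ‖u‖ ^ s) (ball 0 r) := by
  refine integrableOn_ball_of_norm_le_rpow (α := -s) (C := 1) (by simp)
    (by simpa using by linarith) (.of_forall fun u => ?_)
    (measurable_norm.pow_const s).aestronglyMeasurable
  rw [neg_neg, one_mul, Real.norm_of_nonneg (by positivity)]

lemma integrableOn_norm_rpow_compl_ball {s : ℝ} (hs : s < -2) {r : ℝ} (hr : 0 < r) :
    IntegrableOn (fun u : ℂ => ‖u‖ ^ s) (ball 0 r)ᶜ := by
  have key : Integrable (fun u : ℂ => (Set.Ici r).indicator (fun y => y ^ s) ‖u‖) := by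
    rw [integrable_fun_norm_addHaar volume (f := (Set.Ici r).indicator (fun y => y ^ s))]
    have h1 : IntegrableOn (fun y : ℝ => y ^ (s + 1)) (Set.Ici r) :=
      (integrableOn_Ici_iff_integrableOn_Ioi (by simp)).2
        (integrableOn_Ioi_rpow_of_lt (by linarith) hr)
    rw [← integrable_indicator_iff measurableSet_Ici] at h1
    refine h1.integrableOn.congr_fun (fun y hy => ?_) measurableSet_Ioi
    have hy : 0 < y := hy
    by_cases h : y ∈ Set.Ici r
    · simp [h, Real.rpow_add_one hy.ne', mul_comm]
    · simp [h]
  rw [← integrable_indicator_iff measurableSet_ball.compl]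
  refine key.congr (.of_forall fun u => ?_)
  by_cases h : r ≤ ‖u‖
  · simp [h]
  · simp [h]

/-- The weight `‖u‖ ^ (β - 2) / ‖1 - u‖`. For `0 < β < 1` it is integrable over the
plane: the singularities at `0` and `1` are weak, and it decays like `‖u‖ ^ (β - 3)`. It dominates
the kernels of the Hölder estimates below. -/
noncomputable def weight (β : ℝ) (u : ℂ) : ℝ := ‖u‖ ^ (β - 2) / ‖1 - u‖

lemma weight_nonneg (β : ℝ) (u : ℂ) : 0 ≤ weight β u := by unfold weight; positivity

lemma integrable_weight {β : ℝ} (h0 : 0 < β) (h1 : β < 1) : Integrable (weight β) := by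
  have i1 := (integrable_indicator_iff measurableSet_ball).2
    ((integrableOn_norm_rpow_ball (s := β - 2) (by linarith) (1 / 2)).const_mul 2)
  have i2 := ((integrable_indicator_iff measurableSet_ball).2
    ((integrableOn_norm_rpow_ball (s := -1) (by norm_num) (1 / 2)).const_mul 4)).comp_sub_left 1
  have i3 := (integrable_indicator_iff measurableSet_ball.compl).2
    ((integrableOn_norm_rpow_compl_ball (s := β - 3) (by linarith)
      (one_half_pos (α := ℝ))).const_mul 3)
  have n1 : ∀ u : ℂ, 0 ≤ (ball (0 : ℂ) (1 / 2)).indicator (fun u => 2 * ‖u‖ ^ (β - 2)) u :=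
    fun u => Set.indicator_nonneg (fun u _ => by positivity) u
  have n2 : ∀ u : ℂ, 0 ≤ (ball (0 : ℂ) (1 / 2)).indicator (fun u => 4 * ‖u‖ ^ (-1 : ℝ)) (1 - u) :=
    fun u => Set.indicator_nonneg (fun u _ => by positivity) _
  have n3 : ∀ u : ℂ, 0 ≤ (ball (0 : ℂ) (1 / 2))ᶜ.indicator (fun u => 3 * ‖u‖ ^ (β - 3)) u :=
    fun u => Set.indicator_nonneg (fun u _ => by positivity) u
  refine ((i1.add i2).add i3).mono'
    ((measurable_norm.pow_const _).div (by fun_prop)).aestronglyMeasurable (.of_forall fun u => ?_)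
  rw [Real.norm_of_nonneg (weight_nonneg β u)]
  simp only [Pi.add_apply]
  have tri : 1 ≤ ‖1 - u‖ + ‖u‖ := by simpa using norm_add_le (1 - u) u
  have tri' : ‖u‖ ≤ ‖1 - u‖ + 1 := by simpa [norm_sub_rev] using norm_add_le (u - 1) 1
  unfold weight
  by_cases hu : ‖u‖ < 1 / 2
  · have e1 : (ball (0 : ℂ) (1 / 2)).indicator (fun u => 2 * ‖u‖ ^ (β - 2)) u
        = 2 * ‖u‖ ^ (β - 2) := Set.indicator_of_mem (by simpa using hu) _
    have : ‖u‖ ^ (β - 2) / ‖1 - u‖ ≤ 2 * ‖u‖ ^ (β - 2) := by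
      rw [div_le_iff₀ (by linarith)]
      have : 0 ≤ ‖u‖ ^ (β - 2) := by positivity
      nlinarith
    linarith [n2 u, n3 u]
  · push Not at hu
    by_cases hv : ‖1 - u‖ < 1 / 2
    · have e2 : (ball (0 : ℂ) (1 / 2)).indicator (fun u => 4 * ‖u‖ ^ (-1 : ℝ)) (1 - u)
          = 4 * ‖1 - u‖ ^ (-1 : ℝ) := Set.indicator_of_mem (by simpa using hv) _
      have : ‖u‖ ^ (β - 2) ≤ 4 := by
        calc ‖u‖ ^ (β - 2) ≤ (1 / 2) ^ (β - 2) :=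
              Real.rpow_le_rpow_of_nonpos (by norm_num) hu (by linarith)
          _ ≤ (1 / 2 : ℝ) ^ (-2 : ℝ) :=
              Real.rpow_le_rpow_of_exponent_ge (by norm_num) (by norm_num) (by linarith)
          _ = 4 := by norm_num [Real.rpow_neg]
      have : ‖u‖ ^ (β - 2) / ‖1 - u‖ ≤ 4 * ‖1 - u‖ ^ (-1 : ℝ) := by
        rw [Real.rpow_neg_one, ← div_eq_mul_inv]
        gcongr
      linarith [n1 u, n3 u]
    · push Not at hv
      have e3 : (ball (0 : ℂ) (1 / 2))ᶜ.indicator (fun u => 3 * ‖u‖ ^ (β - 3)) u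
          = 3 * ‖u‖ ^ (β - 3) := Set.indicator_of_mem (by simpa using hu) _
      have hu0 : 0 < ‖u‖ := by linarith
      have : ‖u‖ ^ (β - 2) / ‖1 - u‖ ≤ 3 * ‖u‖ ^ (β - 3) := by
        rw [show β - 2 = (β - 3) + 1 by ring, Real.rpow_add_one hu0.ne',
          div_le_iff₀ (by linarith)]
        have : 0 ≤ ‖u‖ ^ (β - 3) := by positivity
        nlinarith
      linarith [n1 u, n2 u]

lemma norm_rpow_le_weight {β : ℝ} {u : ℂ} {ρ : ℝ} (hu : ‖u‖ ≤ ρ) (h1 : u ≠ 1) :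
    ‖u‖ ^ (β - 2) ≤ (1 + ρ) * weight β u := by
  have hpos : 0 < ‖1 - u‖ := norm_pos_iff.2 (sub_ne_zero.2 h1.symm)
  have : ‖1 - u‖ ≤ 1 + ρ := (norm_sub_le _ _).trans (by simpa using hu)
  unfold weight
  rw [mul_div_assoc', le_div_iff₀ hpos, mul_comm]
  gcongr

/-- The integral of an integrable function over the plane can be computed by first averaging over
rotations. -/
lemma integral_eq_integral_circleAverage {F : ℂ → ℂ} (hF : Integrable F) :
    ∫ u, F u = ∫ u, Real.circleAverage (fun ζ => F (ζ * u)) 0 1 := by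
  set ν : Measure ℝ := volume.restrict (Set.Ioc 0 (2 * Real.pi)) with hν
  have hmp : MeasurePreserving (fun p : ℝ × ℂ => (p.1, circleMap 0 1 p.1 * p.2))
      (ν.prod volume) (ν.prod volume) := by
    refine (MeasurePreserving.id ν).skew_product (g := fun θ u => circleMap 0 1 θ * u) ?_ ?_
    · exact (by fun_prop : Continuous fun p : ℝ × ℂ => circleMap 0 1 p.1 * p.2).measurable
    · refine .of_forall fun θ => ?_
      have hc : ‖circleMap 0 1 θ‖ = 1 := by simp
      rw [map_mul_left_volume_complex (norm_pos_iff.1 (by rw [hc]; norm_num)), hc]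
      simp
  have hint : Integrable (fun p : ℝ × ℂ => F (circleMap 0 1 p.1 * p.2)) (ν.prod volume) :=
    hmp.integrable_comp_of_integrable (g := fun p : ℝ × ℂ => F p.2) (hF.comp_snd ν)
  have hswap := integral_integral_swap (f := fun θ u => F (circleMap 0 1 θ * u)) hint
  have hleft : ∀ θ : ℝ, ∫ u, F (circleMap 0 1 θ * u) = ∫ u, F u := fun θ => by
    rw [integral_comp_mul_left_complex (by simp)]
    simp
  simp only [hleft] at hswap
  have hν' : ν.real Set.univ = 2 * Real.pi := by
    simp [hν, Measure.real, Real.pi_pos.le]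
  rw [integral_const, hν'] at hswap
  simp only [Real.circleAverage, integral_smul,
    intervalIntegral.integral_of_le Real.two_pi_pos.le]
  rw [← hν, ← hswap, smul_smul, inv_mul_cancel₀ Real.two_pi_pos.ne', one_smul]

/-! ### Cancellation in the kernels -/

/-- The principal value of `∫ 1 / u ^ 2` vanishes: multiplication by `i` preserves the annulus and
changes the sign of the integrand. -/
lemma setIntegral_annulus_one_div_sq (ε ρ : ℝ) :
    ∫ u in ball (0 : ℂ) ρ \ ball 0 ε, 1 / u ^ 2 = 0 := by
  have hm : MeasurableSet (ball (0 : ℂ) ρ \ ball 0 ε) := measurableSet_ball.diff measurableSet_ball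
  rw [← integral_indicator hm]
  set F : ℂ → ℂ := (ball (0 : ℂ) ρ \ ball 0 ε).indicator fun u => 1 / u ^ 2
  have h := integral_comp_mul_left_complex Complex.I_ne_zero F
  have hF : ∀ u, F (Complex.I * u) = -F u := fun u => by
    classical
    simp only [F, Set.indicator_apply, Set.mem_sdiff, mem_ball_zero_iff, norm_mul, Complex.norm_I,
      one_mul, mul_pow, Complex.I_sq]
    split_ifs
    · rw [neg_one_mul, div_neg]
    · simp
  simp only [hF, integral_neg, Complex.norm_I, Complex.ofReal_one, one_pow, inv_one,
    one_mul] at h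
  exact self_eq_neg.1 h.symm

/-- The Beurling kernel with its singularity removed. -/
noncomputable def farKernel (u : ℂ) : ℂ := (ball (0 : ℂ) 2)ᶜ.indicator (fun u => 1 / u ^ 2) u

lemma measurable_farKernel : Measurable farKernel :=
  (by fun_prop : Measurable fun u : ℂ => 1 / u ^ 2).indicator measurableSet_ball.compl

lemma farKernel_of_le {u : ℂ} (h : 2 ≤ ‖u‖) : farKernel u = 1 / u ^ 2 :=
  Set.indicator_of_mem (by simpa using h) _

lemma farKernel_of_lt {u : ℂ} (h : ‖u‖ < 2) : farKernel u = 0 :=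
  Set.indicator_of_notMem (by simpa using h) _

lemma norm_farKernel_le (u : ℂ) : ‖farKernel u‖ ≤ 1 / 4 := by
  rcases lt_or_ge ‖u‖ 2 with h | h
  · rw [farKernel_of_lt h]; norm_num
  · rw [farKernel_of_le h, norm_div, norm_one, norm_pow]
    exact one_div_le_one_div_of_le (by norm_num) (by nlinarith)

lemma norm_farKernel_sub_le {u : ℂ} (hu : 1 ≤ ‖u‖) (h1 : u ≠ 1) :
    ‖farKernel u - farKernel (u - 1)‖ ≤ 18 / (‖u‖ ^ 2 * ‖1 - u‖) := by
  have hpos : 0 < ‖1 - u‖ := norm_pos_iff.2 (sub_ne_zero.2 h1.symm)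
  have hu0 : 0 < ‖u‖ := by linarith
  have tri : ‖u‖ ≤ ‖1 - u‖ + 1 := by simpa [norm_sub_rev] using norm_add_le (u - 1) 1
  have tri' : ‖1 - u‖ ≤ 1 + ‖u‖ := by simpa using norm_sub_le 1 u
  rw [le_div_iff₀ (by positivity)]
  rcases lt_or_ge ‖u‖ 3 with h | h
  · have hD : ‖farKernel u - farKernel (u - 1)‖ ≤ 1 / 2 := (norm_sub_le _ _).trans (by
      linarith [norm_farKernel_le u, norm_farKernel_le (u - 1)])
    calc ‖farKernel u - farKernel (u - 1)‖ * (‖u‖ ^ 2 * ‖1 - u‖) ≤ (1 / 2) * (3 ^ 2 * 4) := by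
          gcongr; linarith
      _ = 18 := by norm_num
  · have hu' : u ≠ 0 := norm_pos_iff.1 hu0
    have hu1 : u - 1 ≠ 0 := sub_ne_zero.2 h1
    rw [farKernel_of_le (by linarith), farKernel_of_le (by rw [norm_sub_rev]; linarith),
      show 1 / u ^ 2 - 1 / (u - 1) ^ 2 = (1 - 2 * u) / (u ^ 2 * (1 - u) ^ 2) by
        have : 1 - u ≠ 0 := sub_ne_zero.2 h1.symm
        field_simp
        ring]
    rw [norm_div, norm_mul, norm_pow, norm_pow]
    have hnum : ‖1 - 2 * u‖ ≤ ‖1 - u‖ + ‖u‖ := by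
      rw [show 1 - 2 * u = (1 - u) - u by ring]; exact norm_sub_le _ _
    have : ‖1 - 2 * u‖ / (‖u‖ ^ 2 * ‖1 - u‖ ^ 2) * (‖u‖ ^ 2 * ‖1 - u‖) = ‖1 - 2 * u‖ / ‖1 - u‖ := by
      field_simp
    rw [this, div_le_iff₀ hpos]
    linarith

lemma norm_rpow_mul_farKernel_sub_le {β : ℝ} {u : ℂ} (h1 : u ≠ 1) :
    ‖u‖ ^ β * ‖farKernel u - farKernel (u - 1)‖ ≤ 18 * weight β u := by
  rcases lt_or_ge ‖u‖ 1 with h | h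
  · have : ‖u - 1‖ < 2 := (norm_sub_le _ _).trans_lt (by rw [norm_one]; linarith)
    rw [farKernel_of_lt (by linarith), farKernel_of_lt this]
    simpa using weight_nonneg β u
  · have hu0 : 0 < ‖u‖ := by linarith
    calc _ ≤ ‖u‖ ^ β * (18 / (‖u‖ ^ 2 * ‖1 - u‖)) := by
          gcongr; exact norm_farKernel_sub_le h h1
      _ = 18 * weight β u := by
          unfold weight
          rw [Real.rpow_sub hu0, Real.rpow_two]
          field_simp

lemma norm_farKernel_sub_le_weight {β : ℝ} (h0 : 0 < β) {u : ℂ} (h1 : u ≠ 1) :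
    ‖farKernel u - farKernel (u - 1)‖ ≤ 18 * weight β u := by
  rcases lt_or_ge ‖u‖ 1 with h | h
  · have : ‖u - 1‖ < 2 := (norm_sub_le _ _).trans_lt (by rw [norm_one]; linarith)
    rw [farKernel_of_lt (by linarith), farKernel_of_lt this]
    simpa using weight_nonneg β u
  · refine le_trans ?_ (norm_rpow_mul_farKernel_sub_le h1)
    exact le_mul_of_one_le_left (norm_nonneg _) (Real.one_le_rpow h h0.le)

lemma ae_ne_volume (a : ℂ) : ∀ᵐ u : ℂ, u ≠ a := by simp [ae_iff, measure_singleton]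

lemma integrable_farKernel_sub : Integrable fun u => farKernel u - farKernel (u - 1) := by
  refine ((integrable_weight (β := 1 / 2) (by norm_num) (by norm_num)).const_mul 18).mono'
    (measurable_farKernel.sub (measurable_farKernel.comp (by fun_prop))).aestronglyMeasurable ?_
  filter_upwards [ae_ne_volume 1] with u hu
  exact norm_farKernel_sub_le_weight (by norm_num) hu

/-- The substitution `u ↦ 1 - u` changes the sign of the integrand, since the kernel is even. -/
lemma integral_farKernel_sub : ∫ u, (farKernel u - farKernel (u - 1)) = 0 := by
  have heven : ∀ u, farKernel (-u) = farKernel u := fun u => by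
    classical
    simp [farKernel, Set.indicator_apply]
  have h := integral_sub_left_eq_self (fun u => farKernel u - farKernel (u - 1)) volume (1 : ℂ)
  have hF : ∀ u : ℂ, farKernel (1 - u) - farKernel (1 - u - 1)
      = -(farKernel u - farKernel (u - 1)) := fun u => by
    rw [show 1 - u - 1 = -u by ring, ← neg_sub u 1, heven, heven, neg_sub]
  simp only [hF, integral_neg] at h
  exact self_eq_neg.1 h.symm

/-- The remainder `1 / (1 - u) + 1 / u + 1 / u ^ 2 = 1 / (u ^ 2 (1 - u))` in the first order
expansion of the Cauchy kernel, with its non-integrable part `1 / u ^ 2` removed near `0`. -/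
noncomputable def remainderKernel (u : ℂ) : ℂ :=
  1 / (1 - u) + 1 / u + (ball (0 : ℂ) 1)ᶜ.indicator (fun u => 1 / u ^ 2) u

lemma remainderKernel_of_lt {u : ℂ} (h : ‖u‖ < 1) : remainderKernel u = 1 / (1 - u) + 1 / u := by
  rw [remainderKernel, Set.indicator_of_notMem (by simpa using h), add_zero]

lemma remainderKernel_of_le {u : ℂ} (h : 1 ≤ ‖u‖) (h1 : u ≠ 1) :
    remainderKernel u = 1 / (u ^ 2 * (1 - u)) := by
  rw [remainderKernel, Set.indicator_of_mem (by simpa using h)]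
  have : 1 - u ≠ 0 := sub_ne_zero.2 h1.symm
  have : u ≠ 0 := norm_pos_iff.1 (by linarith)
  field_simp
  ring

lemma measurable_remainderKernel : Measurable remainderKernel :=
  (by fun_prop : Measurable fun u : ℂ => 1 / (1 - u) + 1 / u).add
    ((by fun_prop : Measurable fun u : ℂ => 1 / u ^ 2).indicator measurableSet_ball.compl)

lemma integrable_remainderKernel : Integrable remainderKernel := by
  refine (integrable_weight (β := 1 / 2) (by norm_num) (by norm_num)).mono'
    measurable_remainderKernel.aestronglyMeasurable ?_
  filter_upwards [ae_ne_volume 1, ae_ne_volume 0] with u h1 h0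
  have hpos : 0 < ‖1 - u‖ := norm_pos_iff.2 (sub_ne_zero.2 h1.symm)
  have hu0 : 0 < ‖u‖ := norm_pos_iff.2 h0
  unfold weight
  rcases lt_or_ge ‖u‖ 1 with h | h
  · have h1' : 1 - u ≠ 0 := sub_ne_zero.2 h1.symm
    rw [remainderKernel_of_lt h, show 1 / (1 - u) + 1 / u = u⁻¹ / (1 - u) by field_simp; ring,
      norm_div, norm_inv, ← Real.rpow_neg_one]
    gcongr ?_ / _
    exact Real.rpow_le_rpow_of_exponent_ge hu0 h.le (by norm_num)
  · rw [remainderKernel_of_le h h1, norm_div, norm_mul, norm_one, norm_pow, ← div_div]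
    gcongr ?_ / _
    rw [one_div, ← Real.rpow_two, ← Real.rpow_neg hu0.le]
    exact Real.rpow_le_rpow_of_exponent_le h (by norm_num)

open Real in
lemma circleAverage_remainderKernel_of_lt {u : ℂ} (h0 : u ≠ 0) (h : ‖u‖ < 1) :
    circleAverage (fun ζ => remainderKernel (ζ * u)) 0 1 = 1 := by
  have hne : ∀ ζ : ℂ, ‖ζ‖ ≤ 1 → 1 - ζ * u ≠ 0 := fun ζ hζ h' => by
    have : ‖ζ * u‖ = 1 := by rw [← sub_eq_zero.1 h', norm_one]
    rw [norm_mul] at this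
    nlinarith [norm_nonneg ζ, norm_nonneg u]
  have d1 : DiffContOnCl ℂ (fun ζ : ℂ => 1 / (1 - ζ * u)) (ball 0 |1|) := by
    refine DifferentiableOn.diffContOnCl fun ζ hζ => ?_
    rw [abs_one, closure_ball _ one_ne_zero, mem_closedBall_zero_iff] at hζ
    have := hne ζ hζ
    exact (by fun_prop (disch := assumption) :
      DifferentiableAt ℂ (fun ζ : ℂ => 1 / (1 - ζ * u)) ζ).differentiableWithinAt
  have d2 : DiffContOnCl ℂ (fun ζ : ℂ => ζ / u) (ball 0 |1|) :=
    (by fun_prop : Differentiable ℂ fun ζ : ℂ => ζ / u).diffContOnCl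
  have a1 := d1.circleAverage
  have a2 := d2.circleAverage
  rw [← circleAverage_zero_one_congr_inv] at a2
  have c1 : CircleIntegrable (fun ζ : ℂ => 1 / (1 - ζ * u)) 0 1 := by
    have := d1.continuousOn_ball.mono (sphere_subset_closedBall (x := 0) (ε := |1|))
    exact ContinuousOn.circleIntegrable' this
  have c2 : CircleIntegrable (fun ζ : ℂ => ζ⁻¹ / u) 0 1 := by
    refine ContinuousOn.circleIntegrable' fun ζ hζ => ?_
    have : ζ ≠ 0 := norm_pos_iff.1 (by simp_all)
    exact (by fun_prop (disch := assumption) :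
      ContinuousAt (fun ζ : ℂ => ζ⁻¹ / u) ζ).continuousWithinAt
  have hs : Set.EqOn (fun ζ => remainderKernel (ζ * u))
      ((fun ζ : ℂ => 1 / (1 - ζ * u)) + fun ζ : ℂ => ζ⁻¹ / u) (sphere 0 |1|) := fun ζ hζ => by
    have hζ' : ‖ζ‖ = 1 := by simpa using hζ
    have : ζ ≠ 0 := norm_pos_iff.1 (by rw [hζ']; norm_num)
    simp only [Pi.add_apply]
    rw [remainderKernel_of_lt (by rw [norm_mul, hζ', one_mul]; exact h)]
    congr 1
    field_simp
  rw [circleAverage_congr_sphere hs, circleAverage_add c1 c2, a1, a2]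
  simp

open Real in
lemma circleAverage_remainderKernel_of_gt {u : ℂ} (h : 1 < ‖u‖) :
    circleAverage (fun ζ => remainderKernel (ζ * u)) 0 1 = 0 := by
  have hne : ∀ ζ : ℂ, ‖ζ‖ ≤ 1 → ζ - u ≠ 0 := fun ζ hζ h' => by
    rw [sub_eq_zero.1 h'] at hζ
    linarith
  have hu0 : u ≠ 0 := norm_pos_iff.1 (by linarith)
  -- After `ζ ↦ ζ⁻¹` the integrand extends holomorphically to the disc and vanishes at the centre.
  have d : DiffContOnCl ℂ (fun ζ : ℂ => ζ ^ 3 / (u ^ 2 * (ζ - u))) (ball 0 |1|) := by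
    refine DifferentiableOn.diffContOnCl fun ζ hζ => ?_
    rw [abs_one, closure_ball _ one_ne_zero, mem_closedBall_zero_iff] at hζ
    have : u ^ 2 * (ζ - u) ≠ 0 := mul_ne_zero (pow_ne_zero _ hu0) (hne ζ hζ)
    exact (by fun_prop (disch := assumption) :
      DifferentiableAt ℂ (fun ζ : ℂ => ζ ^ 3 / (u ^ 2 * (ζ - u))) ζ).differentiableWithinAt
  have a := d.circleAverage
  rw [← circleAverage_zero_one_congr_inv] at a
  have hs : Set.EqOn (fun ζ => remainderKernel (ζ * u))
      (fun ζ : ℂ => ζ⁻¹ ^ 3 / (u ^ 2 * (ζ⁻¹ - u))) (sphere 0 |1|) := fun ζ hζ => by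
    have hζ' : ‖ζ‖ = 1 := by simpa using hζ
    have hζ0 : ζ ≠ 0 := norm_pos_iff.1 (by rw [hζ']; norm_num)
    have hn : ‖ζ * u‖ = ‖u‖ := by rw [norm_mul, hζ', one_mul]
    have h1 : ζ * u ≠ 1 := fun h1 => by rw [h1, norm_one] at hn; linarith
    have h2 := hne ζ⁻¹ (by rw [norm_inv, hζ', inv_one])
    have h3 : 1 - ζ * u ≠ 0 := sub_ne_zero.2 h1.symm
    simp only
    rw [remainderKernel_of_le (by rw [hn]; exact h.le) h1,
      show ζ⁻¹ - u = (1 - ζ * u) / ζ by field_simp]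
    field_simp
  rw [circleAverage_congr_sphere hs, a]
  simp

/-- The constant in `∂_z̄ (T g) = g`. By rotation averaging, only the unit disc contributes. -/
lemma integral_remainderKernel : ∫ u, remainderKernel u = Real.pi := by
  rw [integral_eq_integral_circleAverage integrable_remainderKernel]
  have hsph : ∀ᵐ u : ℂ, u ∉ sphere (0 : ℂ) 1 :=
    measure_eq_zero_iff_ae_notMem.1 (Measure.addHaar_sphere volume 0 1)
  have : ∀ᵐ u : ℂ, Real.circleAverage (fun ζ => remainderKernel (ζ * u)) 0 1
      = (ball (0 : ℂ) 1).indicator (fun _ => (1 : ℂ)) u := by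
    filter_upwards [ae_ne_volume 0, hsph] with u h0 h1
    rcases lt_or_ge ‖u‖ 1 with h | h
    · rw [circleAverage_remainderKernel_of_lt h0 h, Set.indicator_of_mem (by simpa using h)]
    · rw [circleAverage_remainderKernel_of_gt (lt_of_le_of_ne h fun h' => h1 (by simp [← h'])),
        Set.indicator_of_notMem (by simpa using h)]
  rw [integral_congr_ae this, integral_indicator measurableSet_ball, setIntegral_const]
  simp [Measure.real, Complex.volume_ball]

/-! ### Hölder functions -/

/-- `g` is Hölder continuous with exponent `β` and constant `M`. -/
def HolderBound (β M : ℝ) (g : ℂ → ℂ) : Prop := ∀ z w, ‖g z - g w‖ ≤ M * ‖z - w‖ ^ β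

namespace HolderBound

variable {β M M' : ℝ} {g g' : ℂ → ℂ}

lemma nonneg (hg : HolderBound β M g) : 0 ≤ M := by
  have := (norm_nonneg _).trans (hg 1 0)
  simpa using this

lemma continuous (hβ : 0 < β) (hg : HolderBound β M g) : Continuous g := by
  refine continuous_iff_continuousAt.2 fun z => tendsto_iff_norm_sub_tendsto_zero.2 ?_
  refine squeeze_zero (fun _ => norm_nonneg _) (fun w => hg w z) ?_
  have : Continuous fun w => M * ‖w - z‖ ^ β :=
    continuous_const.mul (Continuous.rpow_const (by fun_prop) fun _ => Or.inr hβ.le)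
  simpa [Real.zero_rpow hβ.ne'] using this.tendsto z

lemma comp_affine (hg : HolderBound β M g) (z e : ℂ) :
    HolderBound β (M * ‖e‖ ^ β) fun u => g (z + e * u) := fun u v => by
  refine (hg _ _).trans_eq ?_
  rw [add_sub_add_left_eq_sub, ← mul_sub, norm_mul, Real.mul_rpow (norm_nonneg _) (norm_nonneg _),
    mul_assoc]

lemma comp_add (hg : HolderBound β M g) (z : ℂ) : HolderBound β M fun u => g (z + u) := by
  simpa using hg.comp_affine z 1

lemma add (hg : HolderBound β M g) (hg' : HolderBound β M' g') :
    HolderBound β (M + M') fun u => g u + g' u := fun u v => by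
  rw [add_sub_add_comm, add_mul]
  exact (norm_add_le _ _).trans (add_le_add (hg u v) (hg' u v))

lemma mono (hg : HolderBound β M g) (h : M ≤ M') : HolderBound β M' g := fun u v =>
  (hg u v).trans (by gcongr)

end HolderBound

lemma HasCompactSupport.comp_complex_affine {g : ℂ → ℂ} (hc : HasCompactSupport g) (z : ℂ) {e : ℂ}
    (he : e ≠ 0) : HasCompactSupport fun u => g (z + e * u) :=
  hc.comp_homeomorph ((Homeomorph.mulLeft₀ e he).trans (Homeomorph.addLeft z))

lemma HasCompactSupport.comp_complex_add {g : ℂ → ℂ} (hc : HasCompactSupport g) (z : ℂ) :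
    HasCompactSupport fun u => g (z + u) :=
  hc.comp_homeomorph (Homeomorph.addLeft z)

/-! ### The Beurling transform of a Hölder function -/

section Beurling

variable {β M : ℝ} {g : ℂ → ℂ}

lemma norm_regularized_le (hg : HolderBound β M g) {ρ : ℝ} (hρ : 0 < ρ) {u : ℂ} (hu0 : u ≠ 0)
    (hu1 : u ≠ 1) : ‖(g u - (ball (0 : ℂ) ρ).indicator (fun _ => g 0) u) / u ^ 2‖
      ≤ M * (1 + ρ) * weight β u + 1 / ρ ^ 2 * ‖g u‖ := by
  have hM := hg.nonneg
  have hu : 0 < ‖u‖ := norm_pos_iff.2 hu0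
  have hw := weight_nonneg β u
  rw [norm_div, norm_pow]
  rcases lt_or_ge ‖u‖ ρ with h | h
  · rw [Set.indicator_of_mem (by simpa using h)]
    have : ‖g u - g 0‖ / ‖u‖ ^ 2 ≤ M * (1 + ρ) * weight β u := by
      calc ‖g u - g 0‖ / ‖u‖ ^ 2 ≤ M * ‖u‖ ^ β / ‖u‖ ^ 2 := by
            gcongr; simpa using hg u 0
        _ = M * ‖u‖ ^ (β - 2) := by rw [Real.rpow_sub hu, Real.rpow_two, mul_div_assoc]
        _ ≤ M * ((1 + ρ) * weight β u) := by gcongr; exact norm_rpow_le_weight h.le hu1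
        _ = _ := by ring
    have : 0 ≤ 1 / ρ ^ 2 * ‖g u‖ := by positivity
    linarith
  · rw [Set.indicator_of_notMem (by simpa using h), sub_zero]
    have : ‖g u‖ / ‖u‖ ^ 2 ≤ 1 / ρ ^ 2 * ‖g u‖ := by
      rw [one_div_mul_eq_div]; gcongr
    have : 0 ≤ M * (1 + ρ) * weight β u := by positivity
    linarith

lemma integrable_regularized (h0 : 0 < β) (h1 : β < 1) (hg : HolderBound β M g)
    (hc : HasCompactSupport g) {ρ : ℝ} (hρ : 0 < ρ) :
    Integrable fun u => (g u - (ball (0 : ℂ) ρ).indicator (fun _ => g 0) u) / u ^ 2 := by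
  have hcont := hg.continuous h0
  have hi := hcont.integrable_of_hasCompactSupport hc (μ := volume)
  refine (((integrable_weight h0 h1).const_mul (M * (1 + ρ))).add
    (hi.norm.const_mul (1 / ρ ^ 2))).mono' ?_ ?_
  · exact ((hcont.measurable.sub (measurable_const.indicator measurableSet_ball)).div
      (by fun_prop)).aestronglyMeasurable
  filter_upwards [ae_ne_volume 0, ae_ne_volume 1] with u hu0 hu1
  exact norm_regularized_le hg hρ hu0 hu1

lemma truncatedBeurling_eq_comp_add (g : ℂ → ℂ) (z : ℂ) :
    truncatedBeurling g z = truncatedBeurling (fun u => g (z + u)) 0 := by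
  ext ε
  unfold truncatedBeurling
  rw [← integral_indicator measurableSet_ball.compl, ← integral_indicator measurableSet_ball.compl,
    ← integral_add_left_eq_self _ z]
  congr 2 with u
  classical
  simp [Set.indicator_apply]

lemma integrableOn_div_sq (hcont : Continuous g) (hc : HasCompactSupport g) (z : ℂ) {ε : ℝ}
    (hε : 0 < ε) : IntegrableOn (fun w => g w / (w - z) ^ 2) (ball z ε)ᶜ := by
  have hi := hcont.integrable_of_hasCompactSupport hc (μ := volume)
  refine Integrable.mono' (hi.norm.const_mul (1 / ε ^ 2)).integrableOn
    (hcont.measurable.div (by fun_prop)).aestronglyMeasurable ?_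
  refine (ae_restrict_iff' measurableSet_ball.compl).2 (.of_forall fun u hu => ?_)
  have hu : ε ≤ ‖u - z‖ := by simpa [dist_eq_norm] using hu
  rw [norm_div, norm_pow, one_div_mul_eq_div]
  gcongr

lemma tendsto_truncatedBeurling_zero (h0 : 0 < β) (h1 : β < 1) (hg : HolderBound β M g)
    (hc : HasCompactSupport g) {ρ : ℝ} (hρ : 0 < ρ) :
    Tendsto (truncatedBeurling g 0) (𝓝[>] 0) (𝓝 (-(1 / (Real.pi : ℂ)) *
      ∫ u, (g u - (ball (0 : ℂ) ρ).indicator (fun _ => g 0) u) / u ^ 2)) := by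
  set r : ℂ → ℂ := fun u => (g u - (ball (0 : ℂ) ρ).indicator (fun _ => g 0) u) / u ^ 2 with hr
  have hri : Integrable r := integrable_regularized h0 h1 hg hc hρ
  have hlim : Tendsto (fun ε : ℝ => ∫ u, (ball (0 : ℂ) ε)ᶜ.indicator r u) (𝓝[>] 0)
      (𝓝 (∫ u, r u)) := by
    refine tendsto_integral_filter_of_dominated_convergence (fun u => ‖r u‖)
      (.of_forall fun ε => (hri.indicator measurableSet_ball.compl).aestronglyMeasurable)
      (.of_forall fun ε => .of_forall fun u => norm_indicator_le_norm_self _ _) hri.norm ?_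
    filter_upwards [ae_ne_volume 0] with u hu
    have hu : 0 < ‖u‖ := norm_pos_iff.2 hu
    refine tendsto_const_nhds.congr' ?_
    filter_upwards [Ioo_mem_nhdsGT hu] with ε hε
    rw [Set.indicator_of_mem (by simpa using hε.2.le)]
  refine (hlim.const_mul (-(1 / (Real.pi : ℂ)))).congr' ?_
  filter_upwards [Ioo_mem_nhdsGT hρ] with ε hε
  unfold truncatedBeurling
  congr 1
  rw [integral_indicator measurableSet_ball.compl]
  have i1 := integrableOn_div_sq (hg.continuous h0) hc 0 hε.1
  simp only [sub_zero] at i1 ⊢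
  have e : ∀ u, g u / u ^ 2 - r u
      = g 0 * (ball (0 : ℂ) ρ).indicator (fun u => 1 / u ^ 2) u := fun u => by
    by_cases hu : u ∈ ball (0 : ℂ) ρ
    · simp only [hr, Set.indicator_of_mem hu]; ring
    · simp only [hr, Set.indicator_of_notMem hu]; ring
  refine (sub_eq_zero.1 ?_).symm
  rw [← integral_sub i1 hri.integrableOn]
  simp only [e]
  rw [integral_const_mul, setIntegral_indicator measurableSet_ball, Set.inter_comm,
    ← Set.sdiff_eq, setIntegral_annulus_one_div_sq, mul_zero]

lemma beurlingConvergesAt_of_holderBound (h0 : 0 < β) (h1 : β < 1) (hg : HolderBound β M g)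
    (hc : HasCompactSupport g) (z : ℂ) : BeurlingConvergesAt g z :=
  ⟨fun _ hε => integrableOn_div_sq (hg.continuous h0) hc z hε, _,
    truncatedBeurling_eq_comp_add g z ▸ tendsto_truncatedBeurling_zero h0 h1 (hg.comp_add z)
      (hc.comp_complex_add z) one_pos⟩

/-- The principal value as an absolutely convergent integral: subtracting `g z` on a ball around
`z` does not change the truncated integrals. -/
lemma beurlingH_eq (h0 : 0 < β) (h1 : β < 1) (hg : HolderBound β M g)
    (hc : HasCompactSupport g) (z : ℂ) {ρ : ℝ} (hρ : 0 < ρ) :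
    beurlingH g z = -(1 / (Real.pi : ℂ)) *
      ∫ u, (g (z + u) - (ball (0 : ℂ) ρ).indicator (fun _ => g z) u) / u ^ 2 := by
  have := tendsto_truncatedBeurling_zero h0 h1 (hg.comp_add z) (hc.comp_complex_add z) hρ
  simp only [add_zero] at this
  unfold beurlingH
  rw [truncatedBeurling_eq_comp_add]
  exact this.limUnder_eq

lemma beurlingH_add {M' : ℝ} {g' : ℂ → ℂ} (h0 : 0 < β) (h1 : β < 1) (hg : HolderBound β M g)
    (hc : HasCompactSupport g) (hg' : HolderBound β M' g') (hc' : HasCompactSupport g') (z : ℂ) :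
    beurlingH (fun w => g w + g' w) z = beurlingH g z + beurlingH g' z := by
  rw [beurlingH_eq h0 h1 (hg.add hg') (hc.add hc') z one_pos,
    beurlingH_eq h0 h1 hg hc z one_pos, beurlingH_eq h0 h1 hg' hc' z one_pos, ← mul_add]
  have i1 := integrable_regularized h0 h1 (hg.comp_add z) (hc.comp_complex_add z) one_pos
  have i2 := integrable_regularized h0 h1 (hg'.comp_add z) (hc'.comp_complex_add z) one_pos
  simp only [add_zero] at i1 i2
  rw [← integral_add i1 i2]
  congr 2 with u
  classical
  simp only [Set.indicator_apply]
  split_ifs <;> ring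

lemma beurlingH_affine (h0 : 0 < β) (h1 : β < 1) (hg : HolderBound β M g)
    (hc : HasCompactSupport g) (z : ℂ) {e : ℂ} (he : e ≠ 0) (v : ℂ) :
    e * beurlingH g (z + e * v) = conj e * beurlingH (fun u => g (z + e * u)) v := by
  have he' : 0 < ‖e‖ := norm_pos_iff.2 he
  rw [beurlingH_eq h0 h1 hg hc _ he', beurlingH_eq h0 h1 (hg.comp_affine z e)
    (hc.comp_complex_affine z he) v one_pos]
  set F : ℂ → ℂ := fun u => (g (z + e * v + u)
    - (ball (0 : ℂ) ‖e‖).indicator (fun _ => g (z + e * v)) u) / u ^ 2 with hF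
  have hs := integral_comp_mul_left_complex he F
  have hr : ∀ u, F (e * u) = (1 / e ^ 2) * ((g (z + e * (v + u))
      - (ball (0 : ℂ) 1).indicator (fun _ => g (z + e * v)) u) / u ^ 2) := fun u => by
    have hb : e * u ∈ ball (0 : ℂ) ‖e‖ ↔ u ∈ ball (0 : ℂ) 1 := by
      simp only [mem_ball_zero_iff, norm_mul]
      exact mul_lt_iff_lt_one_right he'
    classical
    simp only [hF, Set.indicator_apply, hb, mul_add, add_assoc, mul_pow]
    rw [div_mul_div_comm, one_mul]
  simp only [hr] at hs
  rw [integral_const_mul] at hs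
  have hn : (‖e‖ : ℂ) ^ 2 = e * conj e := (Complex.mul_conj' e).symm
  have hce : conj e ≠ 0 := by simpa using he
  rw [hn] at hs
  field_simp at hs ⊢
  rw [← hs]

lemma norm_one_div_pi_le : ‖(1 / (Real.pi : ℂ))‖ ≤ 1 := by
  rw [norm_div, norm_one, Complex.norm_real, Real.norm_of_nonneg Real.pi_pos.le,
    div_le_one Real.pi_pos]
  linarith [Real.pi_gt_three]

lemma HolderBound.norm_le_two_mul (h1 : β ≤ 1) (hg : HolderBound β M g)
    (hsupp : ∀ z, 1 ≤ ‖z‖ → g z = 0) (z : ℂ) : ‖g z‖ ≤ 2 * M := by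
  have hM := hg.nonneg
  rcases lt_or_ge ‖z‖ 1 with h | h
  · have h2 : 1 ≤ ‖z + 2‖ := by
      have : ‖(2 : ℂ)‖ ≤ ‖z + 2‖ + ‖z‖ := by simpa using norm_sub_le (z + 2) z
      rw [Complex.norm_ofNat] at this
      linarith
    have := hg z (z + 2)
    rw [hsupp _ h2, sub_zero, sub_add_cancel_left, norm_neg, Complex.norm_ofNat] at this
    calc ‖g z‖ ≤ M * 2 ^ β := this
      _ ≤ M * 2 ^ (1 : ℝ) := by gcongr; norm_num
      _ = 2 * M := by rw [Real.rpow_one, mul_comm]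
  · rw [hsupp z h, norm_zero]; positivity

lemma hasCompactSupport_of_unit_ball (hsupp : ∀ z, 1 ≤ ‖z‖ → g z = 0) : HasCompactSupport g :=
  HasCompactSupport.intro (isCompact_closedBall 0 1) fun z hz =>
    hsupp z (by simpa using hz : 1 < ‖z‖).le

lemma norm_beurlingH_le (h0 : 0 < β) (h1 : β < 1) (hg : HolderBound β M g)
    (hsupp : ∀ z, 1 ≤ ‖z‖ → g z = 0) (z : ℂ) :
    ‖beurlingH g z‖ ≤ (2 * (∫ u, weight β u) + 2 * Real.pi) * M := by
  have hc := hasCompactSupport_of_unit_ball hsupp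
  have hgi : Integrable g := (hg.continuous h0).integrable_of_hasCompactSupport hc
  have hsup : ∫ u, ‖g u‖ ≤ 2 * Real.pi * M := by
    calc ∫ u, ‖g u‖ ≤ ∫ u, (ball (0 : ℂ) 1).indicator (fun _ => 2 * M) u := by
          refine integral_mono hgi.norm
            ((integrable_indicator_iff measurableSet_ball).2
              (integrableOn_const measure_ball_lt_top.ne)) fun u => ?_
          by_cases h : u ∈ ball (0 : ℂ) 1
          · simpa [h] using hg.norm_le_two_mul h1.le hsupp u
          · have hu : 1 ≤ ‖u‖ := by simpa using h
            simp only [hsupp u hu, norm_zero, Set.indicator_of_notMem h, le_refl]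
      _ = 2 * Real.pi * M := by
          rw [integral_indicator measurableSet_ball, setIntegral_const]
          simp [Measure.real, Complex.volume_ball]
          ring
  rw [beurlingH_eq h0 h1 hg hc z one_pos, norm_mul, norm_neg]
  refine (mul_le_of_le_one_left (norm_nonneg _) norm_one_div_pi_le).trans ?_
  calc _ ≤ ∫ u, (M * (1 + 1) * weight β u + 1 / 1 ^ 2 * ‖g (z + u)‖) := by
        refine norm_integral_le_of_norm_le (((integrable_weight h0 h1).const_mul _).add
          ((hgi.comp_add_left z).norm.const_mul _)) ?_
        filter_upwards [ae_ne_volume 0, ae_ne_volume 1] with u hu0 hu1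
        simpa using norm_regularized_le (hg.comp_add z) one_pos hu0 hu1
    _ = 2 * (∫ u, weight β u) * M + ∫ u, ‖g u‖ := by
        rw [integral_add ((integrable_weight h0 h1).const_mul _)
          ((hgi.comp_add_left z).norm.const_mul _), integral_const_mul, integral_const_mul,
          integral_add_left_eq_self fun u => ‖g u‖]
        ring
    _ ≤ _ := by linarith

lemma integrable_mul_farKernel (hgi : Integrable g) : Integrable fun u => g u * farKernel u :=
  hgi.mul_bdd (c := 1 / 4) measurable_farKernel.aestronglyMeasurable
    (.of_forall norm_farKernel_le)

/-- The Beurling transform splits into a near part, bounded by the Hölder constant alone, and the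
integral against `farKernel`. -/
lemma exists_beurlingH_eq_near_add_far (h0 : 0 < β) (h1 : β < 1) (hg : HolderBound β M g)
    (hc : HasCompactSupport g) (z : ℂ) :
    ∃ N : ℂ, ‖N‖ ≤ M * 3 * ∫ u, weight β u ∧ beurlingH g z = -(1 / (Real.pi : ℂ)) *
      (N + ∫ u, g (z + u) * farKernel u) := by
  have hgi : Integrable g := (hg.continuous h0).integrable_of_hasCompactSupport hc
  have i1 := integrable_regularized h0 h1 (hg.comp_add z) (hc.comp_complex_add z) two_pos
  simp only [add_zero] at i1
  have i2 := integrable_mul_farKernel (hgi.comp_add_left z)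
  refine ⟨(∫ u, (g (z + u) - (ball (0 : ℂ) 2).indicator (fun _ => g z) u) / u ^ 2)
    - ∫ u, g (z + u) * farKernel u, ?_,
    by rw [sub_add_cancel, ← beurlingH_eq h0 h1 hg hc z two_pos]⟩
  rw [← integral_sub i1 i2, ← integral_const_mul]
  refine norm_integral_le_of_norm_le ((integrable_weight h0 h1).const_mul _) ?_
  filter_upwards [ae_ne_volume 0, ae_ne_volume 1] with u hu0 hu1
  have hM := hg.nonneg
  have hu : 0 < ‖u‖ := norm_pos_iff.2 hu0
  have hw := weight_nonneg β u
  rcases lt_or_ge ‖u‖ 2 with h | h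
  · rw [Set.indicator_of_mem (by simpa using h), farKernel_of_lt h, mul_zero, sub_zero, norm_div,
      norm_pow]
    calc ‖g (z + u) - g z‖ / ‖u‖ ^ 2 ≤ M * ‖u‖ ^ β / ‖u‖ ^ 2 := by
          gcongr; simpa using hg (z + u) z
      _ = M * ‖u‖ ^ (β - 2) := by rw [Real.rpow_sub hu, Real.rpow_two, mul_div_assoc]
      _ ≤ M * ((1 + 2) * weight β u) := by gcongr; exact norm_rpow_le_weight h.le hu1
      _ = _ := by ring
  · rw [Set.indicator_of_notMem (by simpa using h), farKernel_of_le h]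
    simp only [sub_zero, mul_one_div, sub_self, norm_zero]
    positivity

lemma norm_beurlingH_zero_sub_one_le (h0 : 0 < β) (h1 : β < 1) (hg : HolderBound β M g)
    (hc : HasCompactSupport g) :
    ‖beurlingH g 0 - beurlingH g 1‖ ≤ M * (24 * ∫ u, weight β u) := by
  have hgi : Integrable g := (hg.continuous h0).integrable_of_hasCompactSupport hc
  obtain ⟨N, hN, e0⟩ := exists_beurlingH_eq_near_add_far h0 h1 hg hc 0
  obtain ⟨N', hN', e1⟩ := exists_beurlingH_eq_near_add_far h0 h1 hg hc 1
  have ishift : Integrable fun u => g u * farKernel (u - 1) := by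
    simpa using (integrable_mul_farKernel (hgi.comp_add_left 1)).comp_sub_right 1
  have hshift : ∫ u, g (1 + u) * farKernel u = ∫ u, g u * farKernel (u - 1) := by
    rw [← integral_add_left_eq_self (fun u => g u * farKernel (u - 1)) 1]
    simp
  -- As the difference of the kernels has integral zero, `g u` may be replaced by `g u - g 0`.
  have hfar : (∫ u, g u * farKernel u) - ∫ u, g (1 + u) * farKernel u
      = ∫ u, (g u - g 0) * (farKernel u - farKernel (u - 1)) := by
    have : (∫ u, (g u * farKernel u - g u * farKernel (u - 1))
        - g 0 * (farKernel u - farKernel (u - 1))) = _ :=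
      integral_sub ((integrable_mul_farKernel hgi).sub ishift)
        (integrable_farKernel_sub.const_mul (g 0))
    rw [integral_const_mul, integral_farKernel_sub, mul_zero, sub_zero,
      integral_sub (integrable_mul_farKernel hgi) ishift, ← hshift] at this
    rw [← this]
    congr 1 with u
    ring
  have hfar_le : ‖∫ u, (g u - g 0) * (farKernel u - farKernel (u - 1))‖
      ≤ M * 18 * ∫ u, weight β u := by
    rw [← integral_const_mul]
    refine norm_integral_le_of_norm_le ((integrable_weight h0 h1).const_mul _) ?_
    filter_upwards [ae_ne_volume 1] with u hu1
    have hM := hg.nonneg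
    rw [norm_mul]
    calc _ ≤ M * ‖u‖ ^ β * ‖farKernel u - farKernel (u - 1)‖ := by
          gcongr; simpa using hg u 0
      _ = M * (‖u‖ ^ β * ‖farKernel u - farKernel (u - 1)‖) := by ring
      _ ≤ M * (18 * weight β u) :=
          mul_le_mul_of_nonneg_left (norm_rpow_mul_farKernel_sub_le hu1) hM
      _ = _ := by ring
  simp only [zero_add] at e0
  rw [e0, e1, ← mul_sub, norm_mul, norm_neg]
  refine (mul_le_of_le_one_left (norm_nonneg _) norm_one_div_pi_le).trans ?_
  rw [add_sub_add_comm, hfar]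
  have t1 := norm_add_le (N - N') (∫ u, (g u - g 0) * (farKernel u - farKernel (u - 1)))
  have t2 := norm_sub_le N N'
  linarith

/-- The Beurling transform preserves Hölder classes with exponent `β < 1`. By affine invariance it
suffices to compare its values at `0` and `1`. -/
lemma HolderBound.beurlingH (h0 : 0 < β) (h1 : β < 1) (hg : HolderBound β M g)
    (hc : HasCompactSupport g) :
    HolderBound β (M * (24 * ∫ u, weight β u)) (beurlingH g) := fun z w => by
  rcases eq_or_ne z w with rfl | hne
  · have : 0 ≤ ∫ u, weight β u := integral_nonneg (weight_nonneg β)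
    have := hg.nonneg
    rw [sub_self, norm_zero]
    positivity
  have he : w - z ≠ 0 := sub_ne_zero.2 hne.symm
  have e0 := beurlingH_affine h0 h1 hg hc z he 0
  have e1 := beurlingH_affine h0 h1 hg hc z he 1
  rw [mul_zero, add_zero] at e0
  rw [mul_one, add_sub_cancel] at e1
  have := norm_beurlingH_zero_sub_one_le h0 h1 (hg.comp_affine z (w - z))
    (hc.comp_complex_affine z he)
  have hn : ‖(w - z) * (_root_.beurlingH g z - _root_.beurlingH g w)‖ = _ :=
    congrArg norm (show _ = conj (w - z) * _ by rw [mul_sub, e0, e1, ← mul_sub])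
  rw [norm_mul, norm_mul, Complex.norm_conj] at hn
  rw [mul_left_cancel₀ (norm_ne_zero_iff.2 he) hn, norm_sub_rev z w]
  refine this.trans_eq (by ring)

end Beurling

/-! ### The Cauchy transform of a Hölder function -/

section Cauchy

variable {β M : ℝ} {g : ℂ → ℂ}

lemma integrable_cauchyKernel (hcont : Continuous g) (hc : HasCompactSupport g) (z : ℂ) :
    Integrable fun w => g w / (z - w) := by
  have hloc : LocallyIntegrable (fun u : ℂ => u⁻¹) :=
    locallyIntegrable_of_norm_le_rpow (C := 1) (α := 1) (by simp) (by simp)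
      (.of_forall fun u => by rw [Real.rpow_neg_one, norm_inv, one_mul])
      measurable_inv.aestronglyMeasurable
  have hc' : HasCompactSupport fun u => g (z - u) := hc.comp_homeomorph (Homeomorph.subLeft z)
  have := (hloc.integrable_smul_left_of_hasCompactSupport
    (hcont.comp (continuous_sub_left z)) hc').comp_sub_left z
  refine this.congr (.of_forall fun w => ?_)
  simp [div_eq_mul_inv]

lemma cauchyT_affine (g : ℂ → ℂ) (z : ℂ) {e : ℂ} (he : e ≠ 0) (v : ℂ) :
    cauchyT g (z + e * v) = conj e * cauchyT (fun u => g (z + e * u)) v := by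
  unfold cauchyT
  have hs := integral_comp_mul_left_complex he fun u => g (z + u) / (e * v - u)
  rw [← integral_add_left_eq_self (fun w => g w / (z + e * v - w)) z]
  simp only [add_sub_add_left_eq_sub]
  have hr : ∀ u, g (z + e * u) / (e * v - e * u) = 1 / e * (g (z + e * u) / (v - u)) := fun u => by
    rw [← mul_sub, div_mul_div_comm, one_mul]
  simp only [hr] at hs
  rw [integral_const_mul] at hs
  have hn : (‖e‖ : ℂ) ^ 2 = e * conj e := (Complex.mul_conj' e).symm
  have hce : conj e ≠ 0 := by simpa using he
  rw [hn] at hs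
  field_simp at hs ⊢
  rw [hs]

/-- The first order expansion of the Cauchy transform for increment `1`. The bound does not involve
the support of `g`, so that rescaling gives the derivative. -/
lemma norm_cauchyT_expansion_le (h0 : 0 < β) (h1 : β < 1) (hg : HolderBound β M g)
    (hc : HasCompactSupport g) :
    ‖cauchyT g 1 - cauchyT g 0 - beurlingH g 0 - g 0‖ ≤ M * ∫ u, weight β u := by
  have hcont := hg.continuous h0
  have i1 := integrable_cauchyKernel hcont hc 1
  have i2 := integrable_cauchyKernel hcont hc 0
  have i3 := integrable_regularized h0 h1 hg hc one_pos
  have i4 := integrable_remainderKernel.const_mul (g 0)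
  have i12 : Integrable fun u => g u / (1 - u) - g u / (0 - u) := i1.sub i2
  have i123 : Integrable fun u => g u / (1 - u) - g u / (0 - u)
      + (g u - (ball (0 : ℂ) 1).indicator (fun _ => g 0) u) / u ^ 2 := i12.add i3
  have hpi : (Real.pi : ℂ) ≠ 0 := by simp [Real.pi_ne_zero]
  have hH := beurlingH_eq h0 h1 hg hc 0 one_pos
  simp only [zero_add] at hH
  have key : cauchyT g 1 - cauchyT g 0 - beurlingH g 0 - g 0 = 1 / (Real.pi : ℂ) *
      ∫ u, (g u / (1 - u) - g u / (0 - u)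
        + (g u - (ball (0 : ℂ) 1).indicator (fun _ => g 0) u) / u ^ 2
        - g 0 * remainderKernel u) := by
    rw [integral_sub i123 i4, integral_add i12 i3, integral_sub i1 i2,
      integral_const_mul, integral_remainderKernel, hH]
    unfold cauchyT
    field_simp
    ring
  rw [key, norm_mul]
  refine (mul_le_of_le_one_left (norm_nonneg _) norm_one_div_pi_le).trans ?_
  rw [← integral_const_mul]
  refine norm_integral_le_of_norm_le ((integrable_weight h0 h1).const_mul _) ?_
  filter_upwards [ae_ne_volume 0, ae_ne_volume 1] with u hu0 hu1
  have hM := hg.nonneg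
  have hu : 0 < ‖u‖ := norm_pos_iff.2 hu0
  have hv : 0 < ‖1 - u‖ := norm_pos_iff.2 (sub_ne_zero.2 hu1.symm)
  have e : g u / (1 - u) - g u / (0 - u)
        + (g u - (ball (0 : ℂ) 1).indicator (fun _ => g 0) u) / u ^ 2
        - g 0 * remainderKernel u = (g u - g 0) / (u ^ 2 * (1 - u)) := by
    have hv' : 1 - u ≠ 0 := sub_ne_zero.2 hu1.symm
    rcases lt_or_ge ‖u‖ 1 with h | h
    · rw [remainderKernel_of_lt h, Set.indicator_of_mem (by simpa using h), zero_sub]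
      field_simp
      ring
    · rw [remainderKernel_of_le h hu1, Set.indicator_of_notMem (by simpa using h), zero_sub]
      field_simp
      ring
  rw [e, norm_div, norm_mul, norm_pow]
  calc _ ≤ M * ‖u‖ ^ β / (‖u‖ ^ 2 * ‖1 - u‖) := by
        gcongr; simpa using hg u 0
    _ = M * weight β u := by
        unfold weight
        rw [Real.rpow_sub hu, Real.rpow_two]
        field_simp

/-- The real-linear map `v ↦ a v + b v̄`. -/
noncomputable def wirtingerCLM (a b : ℂ) : ℂ →L[ℝ] ℂ :=
  a • ContinuousLinearMap.id ℝ ℂ + b • (Complex.conjCLE : ℂ →L[ℝ] ℂ)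

@[simp] lemma wirtingerCLM_apply (a b v : ℂ) : wirtingerCLM a b v = a * v + b * conj v := rfl

lemma norm_wirtingerCLM_le (a b : ℂ) : ‖wirtingerCLM a b‖ ≤ ‖a‖ + ‖b‖ := by
  refine ContinuousLinearMap.opNorm_le_bound _ (by positivity) fun v => ?_
  rw [wirtingerCLM_apply, add_mul]
  refine (norm_add_le _ _).trans_eq ?_
  rw [norm_mul, norm_mul, Complex.norm_conj]

/-- `T g` is differentiable with `∂_z (T g) = H g` and `∂_z̄ (T g) = g`. -/
lemma hasFDerivAt_cauchyT (h0 : 0 < β) (h1 : β < 1) (hg : HolderBound β M g)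
    (hc : HasCompactSupport g) (z : ℂ) :
    HasFDerivAt (cauchyT g) (wirtingerCLM (beurlingH g z) (g z)) z := by
  rw [hasFDerivAt_iff_isLittleO_nhds_zero]
  set C := M * ∫ u, weight β u
  have hle : ∀ e : ℂ, ‖cauchyT g (z + e) - cauchyT g z - wirtingerCLM (beurlingH g z) (g z) e‖
      ≤ (C * ‖e‖ ^ β) * ‖e‖ := fun e => by
    rcases eq_or_ne e 0 with rfl | he
    · simp
    have t1 := cauchyT_affine g z he 1
    have t0 := cauchyT_affine g z he 0
    have h := beurlingH_affine h0 h1 hg hc z he 0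
    rw [mul_zero, add_zero] at t0 h
    rw [mul_one] at t1
    have := norm_cauchyT_expansion_le h0 h1 (hg.comp_affine z e) (hc.comp_complex_affine z he)
    rw [mul_zero, add_zero] at this
    rw [wirtingerCLM_apply, mul_comm _ e, h, t1, t0, mul_comm (g z), ← mul_sub, ← sub_sub,
      ← mul_sub, ← mul_sub, norm_mul, Complex.norm_conj, mul_comm]
    gcongr
    exact this.trans_eq (by ring)
  have hlim : Tendsto (fun e : ℂ => C * ‖e‖ ^ β) (𝓝 0) (𝓝 0) := by
    have : Continuous fun e : ℂ => C * ‖e‖ ^ β :=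
      continuous_const.mul (Continuous.rpow_const continuous_norm fun _ => Or.inr h0.le)
    simpa [Real.zero_rpow h0.ne'] using this.tendsto 0
  refine Asymptotics.isLittleO_iff.2 fun c hcpos => ?_
  filter_upwards [hlim.eventually_le_const hcpos] with e he
  exact (hle e).trans (by gcongr)

end Cauchy

/-! ### The Neumann series -/

/-- A common bound for the Beurling transform in the sup norm and in the Hölder seminorm, on
functions supported in the unit disc. -/
noncomputable def beurlingConst (β : ℝ) : ℝ := 24 * (∫ u, weight β u) + 2 * Real.pi

lemma six_le_beurlingConst (β : ℝ) : 6 ≤ beurlingConst β := by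
  have : 0 ≤ ∫ u, weight β u := integral_nonneg (weight_nonneg β)
  unfold beurlingConst
  linarith [Real.pi_gt_three]

lemma beurlingPow_zero (μ : ℂ → ℂ) : beurlingPow μ 0 = fun _ => 1 := rfl

lemma beurlingPow_succ (μ : ℂ → ℂ) (n : ℕ) :
    beurlingPow μ (n + 1) = beurlingH fun w => μ w * beurlingPow μ n w :=
  Function.iterate_succ_apply' _ _ _

lemma HolderBound.mul_of_unit_ball {β δ B : ℝ} {μ P : ℂ → ℂ} (h1 : β ≤ 1)
    (hμ : HolderBound β δ μ) (hsupp : ∀ z, 1 ≤ ‖z‖ → μ z = 0) (hP : HolderBound β B P)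
    (hB : ∀ z, ‖P z‖ ≤ B) : HolderBound β (3 * δ * B) fun w => μ w * P w := fun z w => by
  have hδ := hμ.nonneg
  rw [show μ z * P z - μ w * P w = μ z * (P z - P w) + (μ z - μ w) * P w by ring]
  refine (norm_add_le _ _).trans ?_
  rw [norm_mul, norm_mul]
  calc _ ≤ 2 * δ * (B * ‖z - w‖ ^ β) + δ * ‖z - w‖ ^ β * B := by
        gcongr
        · exact hμ.norm_le_two_mul h1 hsupp z
        · exact hP z w
        · exact hμ z w
        · exact hB w
    _ = _ := by ring

section Neumann

variable {β δ : ℝ} {μ : ℂ → ℂ}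

/-- `P ↦ H (μ P)` is a contraction for the sup norm and the Hölder seminorm together: the product
with `μ` gains the small factor `3 δ`, and supplies the support in the unit disc that the sup bound
needs. -/
lemma holderBound_and_norm_beurlingH_mul_le {B : ℝ} {P : ℂ → ℂ} (h0 : 0 < β) (h1 : β < 1)
    (hμ : HolderBound β δ μ) (hsupp : ∀ z, 1 ≤ ‖z‖ → μ z = 0)
    (hδ : beurlingConst β * (3 * δ) ≤ 1 / 8) (hP : HolderBound β B P) (hB : ∀ z, ‖P z‖ ≤ B) :
    HolderBound β (B / 8) (beurlingH fun w => μ w * P w) ∧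
      ∀ z, ‖beurlingH (fun w => μ w * P w) z‖ ≤ B / 8 := by
  have hm := hμ.mul_of_unit_ball h1.le hsupp hP hB
  have hs : ∀ z, 1 ≤ ‖z‖ → μ z * P z = 0 := fun z hz => by rw [hsupp z hz, zero_mul]
  have hw : 0 ≤ ∫ u, weight β u := integral_nonneg (weight_nonneg β)
  have hm0 := hm.nonneg
  have hB0 := hP.nonneg
  have hle : beurlingConst β * (3 * δ * B) ≤ B / 8 := by
    nlinarith [mul_le_mul_of_nonneg_right hδ hB0]
  constructor
  · refine (hm.beurlingH h0 h1 (hasCompactSupport_of_unit_ball hs)).mono (le_trans ?_ hle)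
    rw [mul_comm]
    gcongr
    unfold beurlingConst
    linarith [Real.pi_pos]
  · refine fun z => (norm_beurlingH_le h0 h1 hm hs z).trans (le_trans ?_ hle)
    gcongr
    unfold beurlingConst
    linarith

lemma holderBound_and_norm_beurlingPow_le (h0 : 0 < β) (h1 : β < 1) (hμ : HolderBound β δ μ)
    (hsupp : ∀ z, 1 ≤ ‖z‖ → μ z = 0) (hδ : beurlingConst β * (3 * δ) ≤ 1 / 8) (n : ℕ) :
    HolderBound β ((1 / 4) ^ n) (beurlingPow μ n) ∧ ∀ z, ‖beurlingPow μ n z‖ ≤ (1 / 4) ^ n := by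
  induction n with
  | zero =>
    refine ⟨fun z w => ?_, fun z => ?_⟩
    · simp only [beurlingPow_zero, sub_self, norm_zero]
      positivity
    · simp [beurlingPow_zero]
  | succ n ih =>
    obtain ⟨hh, hs⟩ := holderBound_and_norm_beurlingH_mul_le h0 h1 hμ hsupp hδ ih.1 ih.2
    have hle : ((1 : ℝ) / 4) ^ n / 8 ≤ (1 / 4) ^ (n + 1) := by
      have : (0 : ℝ) ≤ (1 / 4) ^ n := by positivity
      rw [pow_succ]
      linarith
    rw [beurlingPow_succ]
    exact ⟨hh.mono hle, fun z => (hs z).trans hle⟩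

/-- The tail `∑_{n ≥ N} (Hμ)ⁿ` of the Neumann series, where `(Hμ)⁰ = 1`. -/
noncomputable def neumannTail (μ : ℂ → ℂ) (N : ℕ) (z : ℂ) : ℂ := ∑' n : ℕ, beurlingPow μ (n + N) z

lemma hasSum_quarter_pow (N : ℕ) (c : ℝ) :
    HasSum (fun n : ℕ => (1 / 4 : ℝ) ^ (n + N) * c) (4 / 3 * (1 / 4) ^ N * c) := by
  have := (hasSum_geometric_of_lt_one (r := (1 / 4 : ℝ)) (by norm_num) (by norm_num)).mul_right
    ((1 / 4) ^ N * c)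
  convert! this using 1
  · ext n; rw [pow_add, mul_assoc]
  · norm_num; ring

lemma summable_quarter_pow (N : ℕ) : Summable fun n : ℕ => (1 / 4 : ℝ) ^ (n + N) := by
  simpa using (hasSum_quarter_pow N 1).summable

lemma summable_beurlingPow (h0 : 0 < β) (h1 : β < 1) (hμ : HolderBound β δ μ)
    (hsupp : ∀ z, 1 ≤ ‖z‖ → μ z = 0) (hδ : beurlingConst β * (3 * δ) ≤ 1 / 8) (N : ℕ) (z : ℂ) :
    Summable fun n => beurlingPow μ (n + N) z :=
  .of_norm_bounded (summable_quarter_pow N) fun n =>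
    (holderBound_and_norm_beurlingPow_le h0 h1 hμ hsupp hδ (n + N)).2 z

lemma norm_neumannTail_le (h0 : 0 < β) (h1 : β < 1) (hμ : HolderBound β δ μ)
    (hsupp : ∀ z, 1 ≤ ‖z‖ → μ z = 0) (hδ : beurlingConst β * (3 * δ) ≤ 1 / 8) (N : ℕ) (z : ℂ) :
    ‖neumannTail μ N z‖ ≤ 2 * (1 / 4) ^ N := by
  have hpos : (0 : ℝ) ≤ (1 / 4) ^ N := by positivity
  refine (tsum_of_norm_bounded (hasSum_quarter_pow N 1) fun n => ?_).trans (by linarith)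
  rw [mul_one]
  exact (holderBound_and_norm_beurlingPow_le h0 h1 hμ hsupp hδ (n + N)).2 z

lemma holderBound_neumannTail (h0 : 0 < β) (h1 : β < 1) (hμ : HolderBound β δ μ)
    (hsupp : ∀ z, 1 ≤ ‖z‖ → μ z = 0) (hδ : beurlingConst β * (3 * δ) ≤ 1 / 8) (N : ℕ) :
    HolderBound β (2 * (1 / 4) ^ N) (neumannTail μ N) := fun z w => by
  unfold neumannTail
  rw [← (summable_beurlingPow h0 h1 hμ hsupp hδ N z).tsum_sub
    (summable_beurlingPow h0 h1 hμ hsupp hδ N w)]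
  refine (tsum_of_norm_bounded (hasSum_quarter_pow N (‖z - w‖ ^ β)) fun n =>
    (holderBound_and_norm_beurlingPow_le h0 h1 hμ hsupp hδ (n + N)).1 z w).trans ?_
  gcongr
  norm_num

lemma neumannTail_eq_add (h0 : 0 < β) (h1 : β < 1) (hμ : HolderBound β δ μ)
    (hsupp : ∀ z, 1 ≤ ‖z‖ → μ z = 0) (hδ : beurlingConst β * (3 * δ) ≤ 1 / 8) (N : ℕ) (z : ℂ) :
    neumannTail μ N z = beurlingPow μ N z + neumannTail μ (N + 1) z := by
  unfold neumannTail
  rw [(summable_beurlingPow h0 h1 hμ hsupp hδ N z).tsum_eq_zero_add, zero_add]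
  simp only [add_right_comm, add_assoc]

/-- The equation `H (μ (1 + h)) = h`. The difference of the two sides does not change when both are
replaced by their tails, and the tails tend to zero. -/
lemma beurlingH_mul_neumannTail_zero (h0 : 0 < β) (h1 : β < 1) (hμ : HolderBound β δ μ)
    (hsupp : ∀ z, 1 ≤ ‖z‖ → μ z = 0) (hδ : beurlingConst β * (3 * δ) ≤ 1 / 8) (z : ℂ) :
    beurlingH (fun w => μ w * neumannTail μ 0 w) z = neumannTail μ 1 z := by
  set D : ℕ → ℂ := fun N =>
    beurlingH (fun w => μ w * neumannTail μ N w) z - neumannTail μ (N + 1) z with hD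
  have hs : ∀ P : ℂ → ℂ, HasCompactSupport fun w => μ w * P w := fun P =>
    hasCompactSupport_of_unit_ball fun z hz => by rw [hsupp z hz, zero_mul]
  have hstep : ∀ N, D N = D (N + 1) := fun N => by
    have hpow := holderBound_and_norm_beurlingPow_le h0 h1 hμ hsupp hδ N
    have hadd := beurlingH_add h0 h1 (hμ.mul_of_unit_ball h1.le hsupp hpow.1 hpow.2) (hs _)
      (hμ.mul_of_unit_ball h1.le hsupp (holderBound_neumannTail h0 h1 hμ hsupp hδ (N + 1))
        (norm_neumannTail_le h0 h1 hμ hsupp hδ (N + 1))) (hs _) z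
    simp only [← mul_add, ← neumannTail_eq_add h0 h1 hμ hsupp hδ N] at hadd
    simp only [hD, hadd, ← beurlingPow_succ, neumannTail_eq_add h0 h1 hμ hsupp hδ (N + 1)]
    ring
  have hconst : ∀ N, D N = D 0 := fun N => by
    induction N with
    | zero => rfl
    | succ N ih => rw [← hstep, ih]
  have hle : ∀ N, ‖D 0‖ ≤ 4 * (1 / 4) ^ N := fun N => by
    rw [← hconst N]
    have a := (holderBound_and_norm_beurlingH_mul_le h0 h1 hμ hsupp hδ
      (holderBound_neumannTail h0 h1 hμ hsupp hδ N)
      (norm_neumannTail_le h0 h1 hμ hsupp hδ N)).2 z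
    have b := norm_neumannTail_le h0 h1 hμ hsupp hδ (N + 1) z
    have hpos : (0 : ℝ) ≤ (1 / 4) ^ N := by positivity
    rw [pow_succ] at b
    refine (norm_sub_le _ _).trans ?_
    linarith
  have hlim : Tendsto (fun N : ℕ => 4 * (1 / 4 : ℝ) ^ N) atTop (𝓝 0) := by
    simpa using (tendsto_pow_atTop_nhds_zero_of_lt_one (r := (1 / 4 : ℝ)) (by norm_num)
      (by norm_num)).const_mul 4
  have : D 0 = 0 := norm_le_zero_iff.1 (ge_of_tendsto' hlim hle)
  exact sub_eq_zero.1 this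

/-! ### The solution of the Beltrami equation -/

lemma density_eq_mul_neumannTail (h0 : 0 < β) (h1 : β < 1) (hμ : HolderBound β δ μ)
    (hsupp : ∀ z, 1 ≤ ‖z‖ → μ z = 0) (hδ : beurlingConst β * (3 * δ) ≤ 1 / 8) :
    (fun w => μ w + μ w * neumannH μ w) = fun w => μ w * neumannTail μ 0 w := by
  ext w
  rw [neumannTail_eq_add h0 h1 hμ hsupp hδ 0, beurlingPow_zero, mul_add, mul_one]
  rfl

lemma holderBound_density (h0 : 0 < β) (h1 : β < 1) (hμ : HolderBound β δ μ)
    (hsupp : ∀ z, 1 ≤ ‖z‖ → μ z = 0) (hδ : beurlingConst β * (3 * δ) ≤ 1 / 8) :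
    HolderBound β (3 * δ * 2) fun w => μ w * neumannTail μ 0 w := by
  simpa using hμ.mul_of_unit_ball h1.le hsupp (holderBound_neumannTail h0 h1 hμ hsupp hδ 0)
    (norm_neumannTail_le h0 h1 hμ hsupp hδ 0)

/-- The small-constant form of the theorem, on the whole plane. -/
theorem beltramiMap_of_small_holderBound (h0 : 0 < β) (h1 : β < 1) (hμ : HolderBound β δ μ)
    (hsupp : ∀ z, 1 ≤ ‖z‖ → μ z = 0) (hδ : beurlingConst β * (3 * δ) ≤ 1 / 8) :
    (∀ (n : ℕ) (z : ℂ), BeurlingConvergesAt (fun w => μ w * beurlingPow μ n w) z) ∧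
      HasSumUniformly (fun (n : ℕ) (z : ℂ) => beurlingPow μ (n + 1) z) (neumannH μ) ∧
      (∀ z : ℂ, Integrable (fun w => (μ w + μ w * neumannH μ w) / (z - w))) ∧
      ContDiff ℝ 1 (beltramiMap μ) ∧
      (∀ z, wirtingerZbar (beltramiMap μ) z = μ z * wirtingerZ (beltramiMap μ) z) ∧
      IsEmbedding (beltramiMap μ) := by
  have hs : ∀ P : ℂ → ℂ, ∀ z, 1 ≤ ‖z‖ → μ z * P z = 0 := fun P z hz => by
    rw [hsupp z hz, zero_mul]
  have hpow := holderBound_and_norm_beurlingPow_le h0 h1 hμ hsupp hδ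
  set g : ℂ → ℂ := fun w => μ w * neumannTail μ 0 w with hg_def
  have hdens : (fun w => μ w + μ w * neumannH μ w) = g :=
    density_eq_mul_neumannTail h0 h1 hμ hsupp hδ
  have hg : HolderBound β (3 * δ * 2) g := holderBound_density h0 h1 hμ hsupp hδ
  have hgs : ∀ z, 1 ≤ ‖z‖ → g z = 0 := hs _
  have hgc := hasCompactSupport_of_unit_ball hgs
  have hHg := beurlingH_mul_neumannTail_zero h0 h1 hμ hsupp hδ
  rw [← hg_def] at hHg
  have hT := hasFDerivAt_cauchyT h0 h1 hg hgc
  have hmap : beltramiMap μ = fun z => z + cauchyT g z := by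
    ext z; rw [beltramiMap, hdens]
  have hderiv : ∀ z, HasFDerivAt (beltramiMap μ)
      (ContinuousLinearMap.id ℝ ℂ + wirtingerCLM (beurlingH g z) (g z)) z := fun z => by
    rw [hmap]; exact (hasFDerivAt_id z).add (hT z)
  have hcontH := (hg.beurlingH h0 h1 hgc).continuous h0
  have hcontg := hg.continuous h0
  have hC1 : ContDiff ℝ 1 (beltramiMap μ) := by
    refine contDiff_one_iff_fderiv.2 ⟨fun z => (hderiv z).differentiableAt, ?_⟩
    rw [show fderiv ℝ (beltramiMap μ) = _ from funext fun z => (hderiv z).fderiv]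
    unfold wirtingerCLM
    fun_prop
  refine ⟨fun n z => ?_, ?_, fun z => ?_, hC1, fun z => ?_, ?_⟩
  · exact beurlingConvergesAt_of_holderBound h0 h1
      (hμ.mul_of_unit_ball h1.le hsupp (hpow n).1 (hpow n).2)
      (hasCompactSupport_of_unit_ball (hs _)) z
  · rw [← hasSumUniformlyOn_univ_iff]
    exact HasSumUniformlyOn.of_norm_le_summable (summable_quarter_pow 1)
      fun n z _ => (hpow (n + 1)).2 z
  · have := integrable_cauchyKernel hcontg hgc z
    rwa [← hdens] at this
  · have hgz : g z = μ z * (1 + beurlingH g z) := by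
      rw [hHg, hg_def]
      simp only
      rw [neumannTail_eq_add h0 h1 hμ hsupp hδ 0, beurlingPow_zero]
    have hZ : wirtingerZ (beltramiMap μ) z = 1 + beurlingH g z := by
      rw [wirtingerZ, (hderiv z).fderiv]
      simp only [add_apply, ContinuousLinearMap.id_apply, wirtingerCLM_apply,
        Complex.conj_I, map_one]
      linear_combination (-(1 + beurlingH g z - g z) / 2) * Complex.I_sq
    have hZbar : wirtingerZbar (beltramiMap μ) z = g z := by
      rw [wirtingerZbar, (hderiv z).fderiv]
      simp only [add_apply, ContinuousLinearMap.id_apply, wirtingerCLM_apply,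
        Complex.conj_I, map_one]
      linear_combination ((1 + beurlingH g z - g z) / 2) * Complex.I_sq
    rw [hZ, hZbar, hgz]
  · -- The derivative of `T g` has norm at most `1 / 2`, so the map is bi-Lipschitz.
    have hδ' : 3 * δ ≤ 1 / 48 := by
      have := six_le_beurlingConst β
      have := hμ.nonneg
      nlinarith
    have hlip : LipschitzWith (1 / 2) (cauchyT g) := by
      refine lipschitzWith_of_nnnorm_fderiv_le (𝕜 := ℝ) (fun z => (hT z).differentiableAt)
        fun z => ?_
      rw [(hT z).fderiv, ← NNReal.coe_le_coe, coe_nnnorm]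
      refine (norm_wirtingerCLM_le _ _).trans ?_
      have a := (holderBound_and_norm_beurlingH_mul_le h0 h1 hμ hsupp hδ
        (holderBound_neumannTail h0 h1 hμ hsupp hδ 0)
        (norm_neumannTail_le h0 h1 hμ hsupp hδ 0)).2 z
      have b := hg.norm_le_two_mul h1.le hgs z
      rw [← hg_def, pow_zero] at a
      push_cast
      linarith
    have hanti : AntilipschitzWith ((1 : ℝ≥0)⁻¹ - 1 / 2)⁻¹ fun z => id z + cauchyT g z :=
      AntilipschitzWith.id.add_lipschitzWith hlip
        (by rw [inv_one, ← NNReal.coe_lt_coe]; norm_num)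
    have huc : UniformContinuous fun z => id z + cauchyT g z :=
      uniformContinuous_id.add hlip.uniformContinuous
    rw [hmap]
    exact (hanti.isUniformEmbedding huc).isEmbedding

end Neumann

/-- A Hölder function supported in a small ball is Hölder for a smaller exponent, with a small
constant. -/
lemma HolderBound.of_support_subset_ball {β A R : ℝ} {μ : ℂ → ℂ} (hβ : 0 < β) (hR : 0 < R)
    (hμ : HolderBound (β + β) A μ) (hsupp : ∀ z, R ≤ ‖z‖ → μ z = 0) :
    HolderBound β (2 * A * (2 * R) ^ β) μ := fun z w => by
  have hA := hμ.nonneg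
  have hsup : ∀ z, ‖μ z‖ ≤ A * ((2 * R) ^ β * (2 * R) ^ β) := fun z => by
    rcases lt_or_ge ‖z‖ R with h | h
    · have hn : ‖(2 * R : ℂ)‖ = 2 * R := by
        rw [norm_mul, Complex.norm_ofNat, Complex.norm_real, Real.norm_of_nonneg hR.le]
      have h2 : R ≤ ‖z + 2 * R‖ := by
        have : ‖(2 * R : ℂ)‖ ≤ ‖z + 2 * R‖ + ‖z‖ := by
          simpa only [add_sub_cancel_left] using norm_sub_le (z + 2 * R) z
        linarith
      have := hμ z (z + 2 * R)
      rwa [hsupp _ h2, sub_zero, sub_add_cancel_left, norm_neg, hn,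
        Real.rpow_add (by positivity)] at this
    · rw [hsupp z h, norm_zero]; positivity
  rcases le_total ‖z - w‖ (2 * R) with h | h
  · rcases (norm_nonneg (z - w)).eq_or_lt with h' | h'
    · refine (hμ z w).trans ?_
      rw [← h', Real.zero_rpow (by linarith), Real.zero_rpow hβ.ne']
      simp
    · calc ‖μ z - μ w‖ ≤ A * (‖z - w‖ ^ β * ‖z - w‖ ^ β) := by
            rw [← Real.rpow_add h']; exact hμ z w
        _ ≤ A * ((2 * R) ^ β * ‖z - w‖ ^ β) := by gcongr
        _ ≤ 2 * A * (2 * R) ^ β * ‖z - w‖ ^ β := by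
            have : 0 ≤ A * ((2 * R) ^ β * ‖z - w‖ ^ β) := by positivity
            linarith
  · calc ‖μ z - μ w‖ ≤ 2 * A * (2 * R) ^ β * (2 * R) ^ β := by
          refine (norm_sub_le _ _).trans ?_
          linarith [hsup z, hsup w]
      _ ≤ 2 * A * (2 * R) ^ β * ‖z - w‖ ^ β := by gcongr

theorem mainTheorem4 (α A : ℝ≥0) (hα₀ : 0 < α) (hα₁ : α ≤ 1) :
    ∃ R₀ : ℝ, 0 < R₀ ∧ ∀ R : ℝ, 0 < R → R ≤ R₀ →
      ∀ μ : ℂ → ℂ, HolderWith A α μ → eLpNorm μ ⊤ volume < 1 →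
        HasCompactSupport μ → tsupport μ ⊆ ball (0 : ℂ) R →
        -- every Beurling transform that occurs in the series exists
        (∀ (n : ℕ) (z : ℂ), BeurlingConvergesAt (fun w => μ w * beurlingPow μ n w) z) ∧
        -- the series converges uniformly to its sum
        HasSumUniformly (fun (n : ℕ) (z : ℂ) => beurlingPow μ (n + 1) z) (neumannH μ) ∧
        -- the Cauchy transform in the formula for the map converges absolutely
        (∀ z : ℂ, Integrable (fun w => (μ w + μ w * neumannH μ w) / (z - w))) ∧
        -- the map is continuously differentiable and solves the Beltrami equation
        ContDiffOn ℝ 1 (beltramiMap μ) (ball (0 : ℂ) R) ∧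
        (∀ z ∈ ball (0 : ℂ) R,
          wirtingerZbar (beltramiMap μ) z = μ z * wirtingerZ (beltramiMap μ) z) ∧
        -- it is a homeomorphism onto its image
        IsEmbedding ((ball (0 : ℂ) R).domRestrict (beltramiMap μ)) := by
  have hα₁' : (α : ℝ) ≤ 1 := by exact_mod_cast hα₁
  have hα₀' : (0 : ℝ) < α := by exact_mod_cast hα₀
  set β : ℝ := α / 2 with hβ
  have h0 : 0 < β := by positivity
  have h1 : β < 1 := by linarith
  have hK := six_le_beurlingConst β
  set K := beurlingConst β
  -- The radius for which `2 A (2 R) ^ β` is at most `1 / (24 K)`.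
  set η : ℝ := 1 / (24 * K) / (2 * A + 1)
  have hη : 0 < η := by positivity
  refine ⟨min 1 (1 / 2 * η ^ β⁻¹), by positivity, fun R hR hR₀ μ hμ _ _ hsupp => ?_⟩
  have hzero : ∀ z, R ≤ ‖z‖ → μ z = 0 := fun z hz =>
    image_eq_zero_of_notMem_tsupport fun h => by
      have := mem_ball_zero_iff.1 (hsupp h)
      linarith
  have hμ' : HolderBound (β + β) A μ := fun z w => by
    have := hμ.dist_le z w
    rwa [dist_eq_norm, dist_eq_norm, ← add_halves (α : ℝ)] at this
  have hsmall : K * (3 * (2 * A * (2 * R) ^ β)) ≤ 1 / 8 := by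
    have hpow : (2 * R) ^ β ≤ η := by
      calc (2 * R) ^ β ≤ (η ^ β⁻¹) ^ β := by
            gcongr
            linarith [hR₀.trans (min_le_right _ _)]
        _ = η := Real.rpow_inv_rpow hη.le h0.ne'
    have hA : (0 : ℝ) ≤ A := A.2
    have hη' : 2 * A * η ≤ 1 / (24 * K) := by
      have : (2 * A + 1) * η = 1 / (24 * K) := by
        simp only [η]; field_simp
      linarith
    calc K * (3 * (2 * A * (2 * R) ^ β)) ≤ K * (3 * (2 * A * η)) := by gcongr
      _ ≤ K * (3 * (1 / (24 * K))) := by gcongr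
      _ = 1 / 8 := by field_simp; norm_num
  obtain ⟨c1, c2, c3, c4, c5, c6⟩ := beltramiMap_of_small_holderBound h0 h1
    (hμ'.of_support_subset_ball h0 hR hzero)
    (fun z hz => hzero z ((hR₀.trans (min_le_left _ _)).trans hz)) hsmall
  exact ⟨c1, c2, c3, c4.contDiffOn, fun z _ => c5 z, c6.comp .subtypeVal⟩
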